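/- Let $n,d\in\mathbb N$. For a real form $f=\sum_\alpha f_\alpha x^\alpha$ of degree $2d$ in $n$ variables let $\operatorname{supp}(f)=\{\alpha\in\mathbb N_0^n: f_\alpha\ne 0\}$, let $\operatorname{New}(f)=\operatorname{conv}(\operatorname{supp}(f))$ with vertex set $V(f)$, and put $$\mathcal S(f)=\{\alpha\in\operatorname{supp}(f):\alpha\in(2\mathbb N_0)^n,\ f_\alpha>0\},\qquad \mathcal I(f)=\operatorname{supp}(f)\setminus\mathcal S(f).$$ The form $f$ is a *circuit* if $\mathcal S(f)=V(f)$, the set $V(f)$ is affinely independent, and either $\mathcal I(f)=\emptyset$ or $\mathcal I(f)=\{\beta\}$ with $\beta$ in the relative interior of $\operatorname{New}(f)$. The form $f$ is *SONC*, written $f\in C_{n,2d}$, if it is a finite sum of circuit forms of degree $2d$ each of which is nonnegative on $\mathbb R^n$. For $\beta\in\mathcal I(f)$ let $\Delta_1,\dots,\Delta_{N(\beta)}$ be the simplices $\Delta$ (of any dimension, i.e. convex hulls of affinely independent sets) whose vertex set $V(\Delta)$ is contained in $\mathcal S(f)$ and which contain $\beta$ in their relative interior. Let $\mathcal R(f)$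 be the set of all $\alpha\in\mathcal S(f)$ that are not a vertex of any of these simplices, for any $\beta\in\mathcal I(f)$. Let $\lambda^{(k)}_{\alpha\beta}>0$ ($\alpha\in V(\Delta_k)$) be the barycentric coordinates of $\beta$ in $\Delta_k$, so that $\sum_{\alpha\in V(\Delta_k)}\lambda^{(k)}_{\alpha\beta}=1$ and $\sum_{\alpha\in V(\Delta_k)}\lambda^{(k)}_{\alpha\beta}\alpha=\beta$, and put $\lambda^{(k)}_{\alpha\beta}=0$ for $\alpha\notin V(\Delta_k)$. A *cancellation-free SONC decomposition* of $f$ consists of scalars $\mu^{(k)}_{\alpha\beta}\ge 0$ and $\nu^{(k)}_\beta\ge 0$ ($\beta\in\mathcal I(f)$, $k\in\{1,\dots,N(\beta)\}$, $\alpha\in\mathcal S(f)\setminus\mathcal R(f)$) such that $$f=\sum_{\beta\in\mathcal I(f)}\sum_{k=1}^{N(\beta)}f_{\beta k}+\sum_{\alpha\in\mathcal R(f)}f_\alpha x^\alpha,\qquad f_{\beta k}=\sum_{\alpha\in\mathcal S(f)\setminus\mathcal R(f)}\mu^{(k)}_{\alpha\beta}f_\alpha x^\alpha+\nu^{(k)}_\beta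 f_\beta x^\beta,$$ where every $f_{\beta k}$ is a nonnegative circuit with $\operatorname{supp}(f_{\beta k})\subseteq V(\Delta_k)\cup\{\beta\}$ (so $\mu^{(k)}_{\alpha\beta}=0$ whenever $\lambda^{(k)}_{\alpha\beta}=0$; some of the coefficients of $f_{\beta k}$, or all of them, may vanish), $\sum_{\beta\in\mathcal I(f)}\sum_{k=1}^{N(\beta)}\mu^{(k)}_{\alpha\beta}=1$ for every $\alpha\in\mathcal S(f)\setminus\mathcal R(f)$, and $\sum_{k=1}^{N(\beta)}\nu^{(k)}_\beta=1$ for every $\beta\in\mathcal I(f)$. **Theorem.** Let $f\in C_{n,2d}$. Then $$\sum_{\beta\in\mathcal I(f)}|f_\beta|\ \le\sum_{\alpha\in\mathcal S(f)\setminus\mathcal R(f)}f_\alpha.$$ Moreover, if equality holds, then for every cancellation-free SONC decomposition of $f$, $$\mu^{(k)}_{\alpha\beta}f_\alpha=\nu^{(k)}_\beta\,\lambda^{(k)}_{\alpha\beta}\,|f_\beta|\qquad\text{for all }\beta\in\mathcal I(f),\ k\in\{1,\dots,N(\beta)\},\ \alpha\in\mathcal S(f)\setminus\mathcal R(f).$$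 -/

import Mathlib

noncomputable section

namespace SONC

open MvPolynomial

variable {n : ℕ}

/-- An exponent vector, seen as a point of real `n`-space. -/
def expVec (a : Fin n →₀ ℕ) : Fin n → ℝ := fun i => (a i : ℝ)

/-- `S(f)`: the exponents of the monomial squares of `f`, i.e. the even exponents in the support
with positive coefficient. -/
def squareExps (f : MvPolynomial (Fin n) ℝ) : Finset (Fin n →₀ ℕ) :=
  open Classical in f.support.filter (fun a => (∀ i, Even (a i)) ∧ 0 < f.coeff a)

/-- `I(f)`: the remaining exponents of the support. -/
def innerExps (f : MvPolynomial (Fin n) ℝ) : Finset (Fin n →₀ ℕ) :=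
  open Classical in f.support \ squareExps f

/-- The Newton polytope of `f`. -/
def newton (f : MvPolynomial (Fin n) ℝ) : Set (Fin n → ℝ) :=
  convexHull ℝ (expVec '' (f.support : Set (Fin n →₀ ℕ)))

/-- `V(f)`: the vertices of the Newton polytope of `f`. -/
def newtonVertices (f : MvPolynomial (Fin n) ℝ) : Set (Fin n → ℝ) :=
  (newton f).extremePoints ℝ

/-- `f` is nonnegative on real `n`-space. -/
def IsPSD (f : MvPolynomial (Fin n) ℝ) : Prop :=
  ∀ x : Fin n → ℝ, 0 ≤ eval x f

/-- Circuits: the exponents of the monomial squares are exactly the vertices of the Newton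
polytope, these are affinely independent, and there is either exactly one further exponent,
lying in the relative interior of the Newton polytope, or none. -/
structure IsCircuit (f : MvPolynomial (Fin n) ℝ) : Prop where
  square_eq_vertices : expVec '' (squareExps f : Set (Fin n →₀ ℕ)) = newtonVertices f
  affineIndependent : AffineIndependent ℝ ((↑) : newtonVertices f → (Fin n → ℝ))
  inner : (∃ b, innerExps f = {b} ∧ expVec b ∈ intrinsicInterior ℝ (newton f)) ∨
    innerExps f = ∅

/-- `f` belongs to `C_{n,2d}`: it is a finite sum of nonnegative circuit forms of degree `2d`. -/
def IsSONC (d : ℕ) (f : MvPolynomial (Fin n) ℝ) : Prop :=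
  ∃ (s : ℕ) (g : Fin s → MvPolynomial (Fin n) ℝ),
    (∀ i, (g i).IsHomogeneous (2 * d) ∧ IsCircuit (g i) ∧ IsPSD (g i)) ∧ f = ∑ i, g i

/-- `D(b)`: the simplices (of any dimension) with vertices in `S(f)` that contain `b` in their
relative interior. A simplex is recorded by its set of vertices, which determines it. -/
def simplices (f : MvPolynomial (Fin n) ℝ) (b : Fin n →₀ ℕ) : Finset (Finset (Fin n →₀ ℕ)) :=
  open Classical in (squareExps f).powerset.filter (fun V =>
    AffineIndependent ℝ (fun a : V => expVec (a : Fin n →₀ ℕ)) ∧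
    expVec b ∈ intrinsicInterior ℝ (convexHull ℝ (expVec '' (V : Set (Fin n →₀ ℕ)))))

/-- `R(f)`: the exponents in `S(f)` that are a vertex of no simplex in any `D(b)`, `b ∈ I(f)`. -/
def redundantExps (f : MvPolynomial (Fin n) ℝ) : Finset (Fin n →₀ ℕ) :=
  open Classical in (squareExps f).filter
    (fun a => ∀ b ∈ innerExps f, ∀ V ∈ simplices f b, a ∉ V)

/-- `S(f) \ R(f)`. -/
def activeExps (f : MvPolynomial (Fin n) ℝ) : Finset (Fin n →₀ ℕ) :=
  open Classical in squareExps f \ redundantExps f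

/-- `l` gives the barycentric coordinates of `b` with respect to the vertex set `V`,
extended by zero outside `V`. -/
structure IsBarycentric (V : Finset (Fin n →₀ ℕ)) (b : Fin n →₀ ℕ)
    (l : (Fin n →₀ ℕ) → ℝ) : Prop where
  pos : ∀ a ∈ V, 0 < l a
  zero_off : ∀ a, a ∉ V → l a = 0
  sum_eq_one : ∑ a ∈ V, l a = 1
  sum_smul : ∑ a ∈ V, l a • expVec a = expVec b

/-- The summand `∑_{a ∈ S(f) \ R(f)} m_a f_a x^a + c f_b x^b` of a decomposition. -/
def piece (f : MvPolynomial (Fin n) ℝ) (b : Fin n →₀ ℕ) (m : (Fin n →₀ ℕ) → ℝ) (c : ℝ) :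
    MvPolynomial (Fin n) ℝ :=
  (∑ a ∈ activeExps f, monomial a (m a * f.coeff a)) + monomial b (c * f.coeff b)

/-- `mu`, `nu`, `lam` are the scalars of a cancellation-free SONC decomposition of `f`. There is
one summand for each `b ∈ I(f)` and each simplex `V ∈ D(b)`; it is a nonnegative circuit
whose exponents lie in `V ∪ {b}`. Some or all of its coefficients may vanish: in general not
every simplex of `D(b)` can be used. -/
structure IsCancellationFreeDecomposition (f : MvPolynomial (Fin n) ℝ)
    (mu : (Fin n →₀ ℕ) → Finset (Fin n →₀ ℕ) → (Fin n →₀ ℕ) → ℝ)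
    (nu : (Fin n →₀ ℕ) → Finset (Fin n →₀ ℕ) → ℝ)
    (lam : (Fin n →₀ ℕ) → Finset (Fin n →₀ ℕ) → (Fin n →₀ ℕ) → ℝ) : Prop where
  decomp : f = (∑ b ∈ innerExps f, ∑ V ∈ simplices f b, piece f b (mu b V) (nu b V)) +
    ∑ a ∈ redundantExps f, monomial a (f.coeff a)
  circuit : ∀ b ∈ innerExps f, ∀ V ∈ simplices f b, IsCircuit (piece f b (mu b V) (nu b V))
  psd : ∀ b ∈ innerExps f, ∀ V ∈ simplices f b, IsPSD (piece f b (mu b V) (nu b V))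
  mu_nonneg : ∀ b ∈ innerExps f, ∀ V ∈ simplices f b, ∀ a ∈ activeExps f, 0 ≤ mu b V a
  nu_nonneg : ∀ b ∈ innerExps f, ∀ V ∈ simplices f b, 0 ≤ nu b V
  mu_zero_off : ∀ b ∈ innerExps f, ∀ V ∈ simplices f b, ∀ a ∈ activeExps f,
    a ∉ V → mu b V a = 0
  sum_mu : ∀ a ∈ activeExps f, ∑ b ∈ innerExps f, ∑ V ∈ simplices f b, mu b V a = 1
  sum_nu : ∀ b ∈ innerExps f, ∑ V ∈ simplices f b, nu b V = 1
  barycentric : ∀ b ∈ innerExps f, ∀ V ∈ simplices f b, IsBarycentric V b (lam b V)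

end SONC

end

/-! At a suitable sign vector a nonnegative circuit takes the value (sum of its square coefficients)
− |inner coefficient|, so this number is nonnegative. Adding over all circuits bounds the inner
coefficients of f by all of its square coefficients; the redundant squares must still be discarded.

Let Q be the hull of S(f); it contains the supports of all circuits (`expVec_mem_squareHull_sum`).
Let A consist of the occurring exponents a such that the segment from a to some b in I(f) can be
prolonged beyond b inside Q. Prolongation is transitive, so a circuit with inner exponent in A has
its whole support in A, while any other circuit contributes only squares to A. Hence signed
coefficients summed over A are nonnegative. Finally A contains I(f), and a Carathéodory argument
that keeps a prescribed vertex shows that the squares in A are active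
(`mem_activeExps_of_overshoot`).

If equality holds, every piece of a cancellation-free decomposition attains its minimum 0 at its
sign vector. In logarithmic coordinates the vanishing gradient says that the weights mu * f_a
balance at b, and barycentric coordinates are unique. -/

namespace SONC

open MvPolynomial

variable {n : ℕ}

/-! ### Relative interiors and Carathéodory's theorem -/

section Convexity

variable {E : Type*} [NormedAddCommGroup E] [NormedSpace ℝ E]

/-- From a point of the relative interior one can move a little further away from any point of
the set. -/
theorem exists_overshoot_of_mem_intrinsicInterior {s : Set E} {a b : E} (ha : a ∈ s)
    (hb : b ∈ intrinsicInterior ℝ s) : ∃ ε : ℝ, 0 < ε ∧ b + ε • (b - a) ∈ s := by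
  obtain ⟨y, hy, rfl⟩ := mem_intrinsicInterior.1 hb
  let a' : affineSpan ℝ s := ⟨a, subset_affineSpan ℝ s ha⟩
  have : Nonempty (affineSpan ℝ s) := ⟨a'⟩
  -- The line runs inside the affine span, where the relative interior is open; the parameter `-t`
  -- points away from `a`.
  let γ : ℝ → affineSpan ℝ s := fun t => AffineMap.lineMap y a' (-t)
  have hγ : Continuous γ := by
    rw [continuous_induced_rng]
    have : (Subtype.val ∘ γ) = fun t : ℝ => (y : E) + t • ((y : E) - a) := by
      funext t
      simp [γ, a', AffineMap.lineMap_apply, smul_sub]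
      abel
    rw [this]
    fun_prop
  have h0 : γ 0 = y := by simp [γ]
  have hnhds : ∀ᶠ t in nhds (0 : ℝ), γ t ∈ interior ((↑) ⁻¹' s : Set (affineSpan ℝ s)) := by
    apply hγ.continuousAt.eventually_mem
    rw [h0]
    exact isOpen_interior.mem_nhds hy
  obtain ⟨t, ht, htpos⟩ := ((hnhds.filter_mono nhdsWithin_le_nhds).and
    (self_mem_nhdsWithin (a := (0 : ℝ)) (s := Set.Ioi 0))).exists
  refine ⟨t, htpos, ?_⟩
  have := interior_subset ht
  have h2 : ((γ t : affineSpan ℝ s) : E) = (y : E) + t • ((y : E) - a) := by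
    simp [γ, a', AffineMap.lineMap_apply, smul_sub]
    abel
  rw [← h2]
  exact this

/-- A half-open segment starting in the relative interior of a convex set stays there. -/
theorem combo_mem_intrinsicInterior {s : Set E} (hs : Convex ℝ s) {y z : E} {t : ℝ}
    (hy : y ∈ intrinsicInterior ℝ s) (hz : z ∈ s) (ht : 0 < t) (ht1 : t ≤ 1) :
    z + t • (y - z) ∈ intrinsicInterior ℝ s := by
  obtain ⟨y', hy', rfl⟩ := mem_intrinsicInterior.1 hy
  let z' : affineSpan ℝ s := ⟨z, subset_affineSpan ℝ s hz⟩
  have : Nonempty (affineSpan ℝ s) := ⟨z'⟩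
  have hval : ∀ p : affineSpan ℝ s, ((AffineMap.homothety z' t p : affineSpan ℝ s) : E)
      = z + t • ((p : E) - z) := by
    intro p
    simp [AffineMap.homothety_apply, z']
    abel
  rw [mem_intrinsicInterior]
  refine ⟨AffineMap.homothety z' t y', ?_, hval y'⟩
  -- The homothety sends the interior to an open set, which convexity keeps inside `s`.
  have hopen : IsOpenMap (AffineMap.homothety z' t) :=
    AffineMap.homothety_isOpenMap z' t ht.ne'
  refine interior_maximal ?_ (hopen _ isOpen_interior) (Set.mem_image_of_mem _ hy')
  rintro _ ⟨p, hp, rfl⟩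
  rw [Set.mem_preimage, hval]
  have hps : (p : E) ∈ s :=
    interior_subset (s := ((↑) ⁻¹' s : Set (affineSpan ℝ s))) hp
  have := hs hz hps (sub_nonneg.2 ht1) ht.le (by ring)
  convert this using 1
  module

/-- Weights representing a point of the convex hull of a finite family. -/
theorem exists_weights_of_mem_convexHull_image {ι : Type*} (v : ι → E) (V : Finset ι) {x : E}
    (hx : x ∈ convexHull ℝ (v '' (V : Set ι))) :
    ∃ w : ι → ℝ, (∀ i ∈ V, 0 ≤ w i) ∧ ∑ i ∈ V, w i = 1 ∧ ∑ i ∈ V, w i • v i = x := by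
  classical
  refine convexHull_min (t := {x | ∃ w : ι → ℝ, (∀ i ∈ V, 0 ≤ w i) ∧ ∑ i ∈ V, w i = 1 ∧
    ∑ i ∈ V, w i • v i = x}) ?_ ?_ hx
  · rintro _ ⟨i, hi, rfl⟩
    have hi : i ∈ V := hi
    refine ⟨Pi.single i 1, fun j _ => ?_, ?_, ?_⟩
    · by_cases h : j = i
      · subst h; simp
      · simp [h]
    · simp [Finset.sum_pi_single', hi]
    · rw [Finset.sum_eq_single i] <;> simp +contextual [hi]
  · rintro _ ⟨w, hw0, hw1, rfl⟩ _ ⟨w', hw0', hw1', rfl⟩ p q hp hq hpq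
    refine ⟨fun i => p * w i + q * w' i, fun i hi => ?_, ?_, ?_⟩
    · exact add_nonneg (mul_nonneg hp (hw0 i hi)) (mul_nonneg hq (hw0' i hi))
    · rw [Finset.sum_add_distrib, ← Finset.mul_sum, ← Finset.mul_sum, hw1, hw1', mul_one, mul_one,
        hpq]
    · simp only [add_smul, Finset.sum_add_distrib, Finset.smul_sum, smul_smul]

/-- A combination with positive weights of all generators lies in the relative interior of
their convex hull. -/
theorem sum_mem_intrinsicInterior [FiniteDimensional ℝ E] {ι : Type*} (v : ι → E) (V : Finset ι)
    (c : ι → ℝ) (hc : ∀ i ∈ V, 0 < c i) (hc1 : ∑ i ∈ V, c i = 1) :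
    ∑ i ∈ V, c i • v i ∈ intrinsicInterior ℝ (convexHull ℝ (v '' (V : Set ι))) := by
  classical
  have hV : V.Nonempty := by
    rw [Finset.nonempty_iff_ne_empty]
    rintro rfl
    simp at hc1
  have hcv := convex_convexHull ℝ (v '' (V : Set ι))
  obtain ⟨y, hy⟩ := Set.Nonempty.intrinsicInterior hcv
    ((hV.to_set.image v).convexHull (𝕜 := ℝ))
  obtain ⟨w, hw0, hw1, hwy⟩ : ∃ w : ι → ℝ, (∀ i ∈ V, 0 ≤ w i) ∧ ∑ i ∈ V, w i = 1 ∧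
      ∑ i ∈ V, w i • v i = y :=
    exists_weights_of_mem_convexHull_image v V (intrinsicInterior_subset hy)
  obtain ⟨ε, hε, hεc⟩ : ∃ ε : ℝ, 0 < ε ∧ ∀ i ∈ V, ε ≤ c i := by
    obtain ⟨i, hi, hmin⟩ := V.exists_min_image c hV
    exact ⟨c i, hc i hi, hmin⟩
  set δ := ε / (1 + ε) with hδ
  have hδ0 : 0 < δ := by positivity
  have hδ1 : δ < 1 := by rw [hδ, div_lt_one (by positivity)]; linarith
  have hδε : δ ≤ ε := div_le_self hε.le (by linarith)
  have hwle : ∀ i ∈ V, w i ≤ 1 := fun i hi => hw1 ▸ Finset.single_le_sum hw0 hi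
  -- Solves `c = δ w + (1 - δ) u`; here `u ≥ 0` because `δ w ≤ δ ≤ ε ≤ c`. The point thus lies on a
  -- segment from `y` to a point of the hull, short of the latter.
  let u : ι → ℝ := fun i => (1 - δ)⁻¹ * (c i - δ * w i)
  have hz : ∑ i ∈ V, u i • v i ∈ convexHull ℝ (v '' (V : Set ι)) := by
    refine hcv.sum_mem (fun i hi => ?_) ?_
      (fun i hi => subset_convexHull ℝ _ (Set.mem_image_of_mem v hi))
    · refine mul_nonneg (inv_nonneg.2 (by linarith)) ?_
      have := mul_le_mul_of_nonneg_left (hwle i hi) hδ0.le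
      have := hεc i hi
      linarith
    · rw [← Finset.mul_sum, Finset.sum_sub_distrib, ← Finset.mul_sum, hc1, hw1, mul_one]
      exact inv_mul_cancel₀ (by linarith)
  have hcomb := combo_mem_intrinsicInterior hcv hy hz hδ0 hδ1.le
  convert hcomb using 1
  have hne : (1 - δ) ≠ 0 := by linarith
  have hzE : (1 - δ) • ∑ i ∈ V, u i • v i = ∑ i ∈ V, c i • v i - δ • y := by
    rw [← hwy, Finset.smul_sum, Finset.smul_sum, ← Finset.sum_sub_distrib]
    refine Finset.sum_congr rfl fun i _ => ?_
    rw [smul_smul, smul_smul, ← sub_smul, mul_inv_cancel_left₀ hne]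
  rw [smul_sub, add_comm, sub_add_eq_add_sub, add_sub_assoc, ← one_smul ℝ (∑ i ∈ V, u i • v i),
    smul_smul, ← sub_smul, mul_one, hzE]
  abel

/-- Carathéodory's theorem with a prescribed generator: a positive combination can be thinned
out to an affinely independent subfamily which still contains a given member. -/
theorem exists_affineIndependent_subset_keeping {ι : Type*} (v : ι → E) (a : ι) (W : Finset ι)
    (c : ι → ℝ) (hc : ∀ i ∈ W, 0 < c i) (ha : a ∈ W) :
    ∃ V ⊆ W, a ∈ V ∧ ∃ c' : ι → ℝ, (∀ i ∈ V, 0 < c' i) ∧ ∑ i ∈ V, c' i = ∑ i ∈ W, c i ∧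
      ∑ i ∈ V, c' i • v i = ∑ i ∈ W, c i • v i ∧ AffineIndependent ℝ (fun i : V => v i) := by
  classical
  induction W using Finset.strongInduction generalizing c with
  | H W ih =>
  by_cases hind : AffineIndependent ℝ (fun i : W => v i)
  · exact ⟨W, subset_rfl, ha, c, hc, rfl, rfl, hind⟩
  -- The sign of the affine dependence is chosen so that moving along `δ` never lowers the weight of
  -- `a`.
  obtain ⟨δ, hδ0, hδv, hδa, i₀, hi₀, hi₀neg⟩ : ∃ δ : ι → ℝ, ∑ i ∈ W, δ i = 0 ∧
      ∑ i ∈ W, δ i • v i = 0 ∧ 0 ≤ δ a ∧ ∃ i ∈ W, δ i < 0 := by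
    rw [affineIndependent_iff] at hind
    push Not at hind
    obtain ⟨s, w, hw0, hwv, e, he, hne⟩ := hind
    let δ : ι → ℝ := fun i => if h : i ∈ W then (if (⟨i, h⟩ : W) ∈ s then w ⟨i, h⟩ else 0) else 0
    have hδ : ∀ i : W, δ i = if i ∈ s then w i else 0 := by
      rintro ⟨i, hi⟩
      simp [δ, hi]
    have h0 : ∑ i ∈ W, δ i = 0 := by
      rw [← Finset.sum_coe_sort]
      simp only [hδ]
      rwa [Finset.sum_ite_mem, Finset.univ_inter]
    have hv : ∑ i ∈ W, δ i • v i = 0 := by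
      rw [← Finset.sum_coe_sort]
      simp only [hδ, ite_smul, zero_smul]
      rwa [Finset.sum_ite_mem, Finset.univ_inter]
    have hne' : δ e ≠ 0 := by rw [hδ, if_pos he]; exact hne
    rcases le_total 0 (δ a) with h | h
    · refine ⟨δ, h0, hv, h, ?_⟩
      by_contra! hcon
      exact hne' ((Finset.sum_eq_zero_iff_of_nonneg hcon).1 h0 e e.2)
    · refine ⟨fun i => -δ i, by simp [h0], by simp [hv], by simpa using h, ?_⟩
      by_contra! hcon
      have := (Finset.sum_eq_zero_iff_of_nonneg hcon).1 (by simp [h0]) e e.2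
      simp at this
      exact hne' this
  -- `j` is an index whose weight reaches zero first; it drops out and `a` survives.
  obtain ⟨j, hj, hjmin⟩ := (W.filter fun i => δ i < 0).exists_min_image (fun i => c i / (-δ i))
    ⟨i₀, Finset.mem_filter.2 ⟨hi₀, hi₀neg⟩⟩
  rw [Finset.mem_filter] at hj
  set t := c j / (-δ j) with ht
  have ht0 : 0 < t := div_pos (hc j hj.1) (by linarith [hj.2])
  let e : ι → ℝ := fun i => c i + t * δ i
  have he0 : ∀ i ∈ W, 0 ≤ e i := by
    intro i hi
    by_cases hneg : δ i < 0
    · have := hjmin i (Finset.mem_filter.2 ⟨hi, hneg⟩)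
      rw [le_div_iff₀ (by linarith)] at this
      simp only [e]
      linarith
    · exact add_nonneg (hc i hi).le (mul_nonneg ht0.le (not_lt.1 hneg))
  have hej : e j = 0 := by
    have : δ j ≠ 0 := hj.2.ne
    simp only [e, ht]
    field_simp
    ring
  have hea : 0 < e a := add_pos_of_pos_of_nonneg (hc a ha) (mul_nonneg ht0.le hδa)
  let W' := W.filter fun i => 0 < e i
  have hsub : W' ⊆ W := Finset.filter_subset _ _
  have hz : ∀ i ∈ W, i ∉ W' → e i = 0 := fun i hi hi' =>
    le_antisymm (not_lt.1 fun h => hi' (Finset.mem_filter.2 ⟨hi, h⟩)) (he0 i hi)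
  obtain ⟨V, hV, haV, c', hc', h1, h2, h3⟩ := ih W'
    (Finset.ssubset_iff_subset_ne.2 ⟨hsub, fun h => by
      have : j ∈ W' := h ▸ hj.1
      exact (Finset.mem_filter.1 this).2.ne' hej⟩) e
    (fun i hi => (Finset.mem_filter.1 hi).2) (Finset.mem_filter.2 ⟨ha, hea⟩)
  refine ⟨V, hV.trans hsub, haV, c', hc', ?_, ?_, h3⟩
  · rw [h1, Finset.sum_subset hsub hz]
    simp [e, Finset.sum_add_distrib, ← Finset.mul_sum, hδ0]
  · rw [h2, Finset.sum_subset hsub fun i hi hi' => by rw [hz i hi hi', zero_smul]]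
    simp [e, Finset.sum_add_distrib, add_smul, mul_smul, ← Finset.smul_sum, hδv]

end Convexity

/-! ### Exponent sets -/

theorem expVec_injective : Function.Injective (expVec : (Fin n →₀ ℕ) → Fin n → ℝ) := by
  intro a b h
  ext i
  exact Nat.cast_injective (R := ℝ) (congrFun h i)

theorem mem_squareExps {f : MvPolynomial (Fin n) ℝ} {a : Fin n →₀ ℕ} :
    a ∈ squareExps f ↔ (∀ i, Even (a i)) ∧ 0 < f.coeff a := by
  simp only [squareExps, Finset.mem_filter, mem_support_iff]
  exact ⟨fun h => h.2, fun h => ⟨h.2.ne', h⟩⟩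

theorem mem_innerExps {f : MvPolynomial (Fin n) ℝ} {a : Fin n →₀ ℕ} :
    a ∈ innerExps f ↔ a ∈ f.support ∧ ¬ ((∀ i, Even (a i)) ∧ 0 < f.coeff a) := by
  rw [innerExps, Finset.mem_sdiff, mem_squareExps]

theorem mem_activeExps {f : MvPolynomial (Fin n) ℝ} {a : Fin n →₀ ℕ} :
    a ∈ activeExps f ↔ a ∈ squareExps f ∧ ∃ b ∈ innerExps f, ∃ V ∈ simplices f b, a ∈ V := by
  simp only [activeExps, redundantExps, Finset.mem_sdiff, Finset.mem_filter, not_and, not_forall,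
    not_not, exists_prop]
  exact ⟨fun h => ⟨h.1, h.2 h.1⟩, fun h => ⟨h.1, fun _ => h.2⟩⟩

theorem mem_simplices {f : MvPolynomial (Fin n) ℝ} {b : Fin n →₀ ℕ} {V : Finset (Fin n →₀ ℕ)} :
    V ∈ simplices f b ↔ V ⊆ squareExps f ∧ AffineIndependent ℝ (fun a : V => expVec a.1) ∧
      expVec b ∈ intrinsicInterior ℝ (convexHull ℝ (expVec '' (V : Set (Fin n →₀ ℕ)))) := by
  simp only [simplices, Finset.mem_filter, Finset.mem_powerset]

/-! ### Sign changes -/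

/-- A sign vector turning the monomial `t x^b` into `-|t|`, unless `t x^b` is a monomial
square. -/
theorem exists_signs_monomial_eq_neg_abs (b : Fin n →₀ ℕ) (t : ℝ)
    (h : ¬ ((∀ i, Even (b i)) ∧ 0 < t)) :
    ∃ s : Fin n → ℝ, (∀ i, s i = 1 ∨ s i = -1) ∧ t * ∏ i, s i ^ b i = -|t| := by
  classical
  by_cases ht : 0 < t
  · have : ∃ i, ¬ Even (b i) := by
      by_contra! hcon
      exact h ⟨hcon, ht⟩
    obtain ⟨i, hi⟩ := this
    refine ⟨Function.update 1 i (-1), fun j => ?_, ?_⟩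
    · by_cases hj : j = i
      · subst hj; simp
      · simp [hj]
    · rw [Finset.prod_eq_single i]
      · simp [(Nat.not_even_iff_odd.1 hi).neg_one_pow, abs_of_pos ht]
      · intro j _ hj
        simp [hj]
      · simp
  · exact ⟨1, fun _ => Or.inl rfl, by simp [abs_of_nonpos (not_lt.1 ht)]⟩

theorem prod_signs_pow_even {s : Fin n → ℝ} (hs : ∀ i, s i = 1 ∨ s i = -1) {a : Fin n →₀ ℕ}
    (ha : ∀ i, Even (a i)) : ∏ i, s i ^ a i = 1 := by
  refine Finset.prod_eq_one fun i _ => ?_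
  rcases hs i with h | h
  · simp [h]
  · rw [h, (ha i).neg_one_pow]

/-- The coefficient `t` of `x^a` after the worst possible sign change. -/
noncomputable def signedCoeff (a : Fin n →₀ ℕ) (t : ℝ) : ℝ :=
  open Classical in if ∀ i, Even (a i) then t else -|t|

theorem signedCoeff_zero (a : Fin n →₀ ℕ) : signedCoeff a 0 = 0 := by simp [signedCoeff]

theorem signedCoeff_of_mem_squareExps {f : MvPolynomial (Fin n) ℝ} {a : Fin n →₀ ℕ}
    (ha : a ∈ squareExps f) : signedCoeff a (f.coeff a) = f.coeff a := by
  rw [signedCoeff, if_pos (mem_squareExps.1 ha).1]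

theorem signedCoeff_of_mem_innerExps {f : MvPolynomial (Fin n) ℝ} {a : Fin n →₀ ℕ}
    (ha : a ∈ innerExps f) : signedCoeff a (f.coeff a) = -|f.coeff a| := by
  rw [signedCoeff]
  split_ifs with h
  · have : f.coeff a ≤ 0 := not_lt.1 fun h' => (mem_innerExps.1 ha).2 ⟨h, h'⟩
    rw [abs_of_nonpos this, neg_neg]
  · rfl

theorem signedCoeff_nonneg_of_notMem_innerExps {f : MvPolynomial (Fin n) ℝ} {a : Fin n →₀ ℕ}
    (ha : a ∉ innerExps f) : 0 ≤ signedCoeff a (f.coeff a) := by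
  by_cases h : a ∈ squareExps f
  · rw [signedCoeff_of_mem_squareExps h]
    exact (mem_squareExps.1 h).2.le
  · have : f.coeff a = 0 := by
      by_contra hne
      exact ha (Finset.mem_sdiff.2 ⟨mem_support_iff.2 hne, h⟩)
    rw [this, signedCoeff_zero]

/-- The triangle inequality at non-even exponents. It lets each circuit use its own sign vector. -/
theorem sum_signedCoeff_le {ι : Type*} (s : Finset ι) (a : Fin n →₀ ℕ) (t : ι → ℝ) :
    ∑ i ∈ s, signedCoeff a (t i) ≤ signedCoeff a (∑ i ∈ s, t i) := by
  unfold signedCoeff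
  split_ifs with h
  · exact le_rfl
  · rw [Finset.sum_neg_distrib]
    exact neg_le_neg (Finset.abs_sum_le_sum_abs _ _)

/-- A nonnegative polynomial with at most one inner exponent stays nonnegative at the point
`(1, …, 1)` after the worst possible sign change. -/
theorem sum_signedCoeff_nonneg {g : MvPolynomial (Fin n) ℝ} (hg : IsPSD g) {b : Fin n →₀ ℕ}
    (hb : innerExps g = {b}) : 0 ≤ ∑ a ∈ g.support, signedCoeff a (g.coeff a) := by
  have hbm : b ∈ innerExps g := by simp [hb]
  obtain ⟨s, hs, hsb⟩ := exists_signs_monomial_eq_neg_abs b (g.coeff b) (mem_innerExps.1 hbm).2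
  have := hg s
  rw [eval_eq'] at this
  refine this.trans_eq (Finset.sum_congr rfl fun a ha => ?_)
  by_cases hab : a = b
  · subst hab
    rw [hsb, signedCoeff_of_mem_innerExps hbm]
  · have ha' : a ∈ squareExps g := by
      by_contra hcon
      have : a ∈ innerExps g := Finset.mem_sdiff.2 ⟨ha, hcon⟩
      rw [hb, Finset.mem_singleton] at this
      exact hab this
    rw [signedCoeff_of_mem_squareExps ha', prod_signs_pow_even hs (mem_squareExps.1 ha').1, mul_one]

/-! ### Prolonging segments in the hull of the squares -/

/-- The convex hull of the monomial squares. -/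
def squareHull (f : MvPolynomial (Fin n) ℝ) : Set (Fin n → ℝ) :=
  convexHull ℝ (expVec '' (squareExps f : Set (Fin n →₀ ℕ)))

/-- In a sum of circuits all exponents of the summands lie in the convex hull of the monomial
squares of the sum. -/
theorem expVec_mem_squareHull_sum {s : ℕ} {g : Fin s → MvPolynomial (Fin n) ℝ}
    (hg : ∀ i, IsCircuit (g i)) (i : Fin s) {a : Fin n →₀ ℕ} (ha : a ∈ (g i).support) :
    expVec a ∈ squareHull (∑ i, g i) := by
  classical
  set f := ∑ i, g i with hf
  let U : Set (Fin n →₀ ℕ) := ⋃ i, ((g i).support : Set (Fin n →₀ ℕ))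
  have hUfin : U.Finite := Set.finite_iUnion fun i => Finset.finite_toSet _
  let K := convexHull ℝ (expVec '' U)
  have hsub : ∀ j, newton (g j) ⊆ K := fun j =>
    convexHull_mono (Set.image_mono
      (Set.subset_iUnion (fun i => ((g i).support : Set (Fin n →₀ ℕ))) j))
  have hext : K.extremePoints ℝ ⊆ expVec '' (squareExps f : Set (Fin n →₀ ℕ)) := by
    intro x hx
    obtain ⟨a, ha, rfl⟩ := extremePoints_convexHull_subset hx
    obtain ⟨i, hi⟩ := Set.mem_iUnion.1 ha
    -- A vertex of `K` is a vertex of every Newton polytope whose support contains it, so its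
    -- coefficients are all positive there and cannot cancel.
    have key : ∀ j, a ∈ (g j).support → a ∈ squareExps (g j) := by
      intro j hj
      have hmem : expVec a ∈ newtonVertices (g j) :=
        inter_extremePoints_subset_extremePoints_of_subset (hsub j)
          ⟨subset_convexHull ℝ _ (Set.mem_image_of_mem _ hj), hx⟩
      rw [← (hg j).square_eq_vertices] at hmem
      obtain ⟨a', ha', h⟩ := hmem
      rwa [expVec_injective h] at ha'
    refine Set.mem_image_of_mem _ (mem_squareExps.2 ⟨(mem_squareExps.1 (key i hi)).1, ?_⟩)
    rw [hf, coeff_sum]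
    refine Finset.sum_pos' (fun j _ => ?_) ⟨i, Finset.mem_univ _, (mem_squareExps.1 (key i hi)).2⟩
    by_cases hj : a ∈ (g j).support
    · exact (mem_squareExps.1 (key j hj)).2.le
    · rw [notMem_support_iff.1 hj]
  have hK : K ⊆ squareHull f := by
    have hcomp : IsCompact K := (hUfin.image _).isCompact_convexHull ℝ
    -- Krein–Milman.
    rw [← closure_convexHull_extremePoints hcomp (convex_convexHull ℝ _)]
    exact closure_minimal (convexHull_mono hext)
      (((squareExps f).finite_toSet.image _).isClosed_convexHull ℝ)
  exact hK (subset_convexHull ℝ _ (Set.mem_image_of_mem _ (Set.mem_iUnion.2 ⟨i, ha⟩)))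

/-- A monomial square is active as soon as the segment from it to an inner exponent can be
prolonged within the convex hull of the monomial squares. -/
theorem mem_activeExps_of_overshoot {f : MvPolynomial (Fin n) ℝ} {a b : Fin n →₀ ℕ}
    (ha : a ∈ squareExps f) (hb : b ∈ innerExps f) {ε : ℝ} (hε : 0 < ε)
    (h : expVec b + ε • (expVec b - expVec a) ∈ squareHull f) : a ∈ activeExps f := by
  classical
  obtain ⟨w, hw0, hw1, hwx⟩ := exists_weights_of_mem_convexHull_image _ _ h
  -- With `x` the prolonged point, `b = (x + ε a) / (1 + ε)`, so `a` gets positive weight.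
  let c : (Fin n →₀ ℕ) → ℝ := fun i => (1 + ε)⁻¹ * (w i + if i = a then ε else 0)
  have hne : (1 + ε) ≠ 0 := by positivity
  have hc0 : ∀ i ∈ squareExps f, 0 ≤ c i := fun i hi => by
    have := hw0 i hi
    have : 0 ≤ (if i = a then ε else 0) := by split_ifs <;> linarith
    positivity
  have hca : 0 < c a := by
    have := hw0 a ha
    simp only [c, if_true]
    positivity
  have hc1 : ∑ i ∈ squareExps f, c i = 1 := by
    rw [← Finset.mul_sum, Finset.sum_add_distrib, hw1, Finset.sum_ite_eq', if_pos ha,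
      inv_mul_cancel₀ hne]
  have hcb : ∑ i ∈ squareExps f, c i • expVec i = expVec b := by
    simp only [c, mul_smul, ← Finset.smul_sum, add_smul, Finset.sum_add_distrib, hwx, ite_smul,
      zero_smul, Finset.sum_ite_eq', if_pos ha]
    rw [inv_smul_eq_iff₀ hne]
    module
  let W := (squareExps f).filter fun i => 0 < c i
  have hW : W ⊆ squareExps f := Finset.filter_subset _ _
  have hz : ∀ i ∈ squareExps f, i ∉ W → c i = 0 := fun i hi hi' =>
    le_antisymm (not_lt.1 fun h => hi' (Finset.mem_filter.2 ⟨hi, h⟩)) (hc0 i hi)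
  obtain ⟨V, hVW, haV, c', hc', h1, h2, h3⟩ := exists_affineIndependent_subset_keeping expVec a W c
    (fun i hi => (Finset.mem_filter.1 hi).2) (Finset.mem_filter.2 ⟨ha, hca⟩)
  rw [Finset.sum_subset hW hz, hc1] at h1
  rw [Finset.sum_subset hW fun i hi hi' => by rw [hz i hi hi', zero_smul], hcb] at h2
  refine mem_activeExps.2 ⟨ha, b, hb, V, mem_simplices.2 ⟨hVW.trans hW, h3, ?_⟩, haV⟩
  rw [← h2]
  exact sum_mem_intrinsicInterior expVec V c' hc' h1

/-- Prolonging segments within a convex set is transitive. -/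
theorem exists_overshoot_trans {E : Type*} [AddCommGroup E] [Module ℝ E] {Q : Set E}
    (hQ : Convex ℝ Q) {a b c : E} {ε δ : ℝ} (hε : 0 < ε) (hδ : 0 < δ)
    (hcb : c + ε • (c - b) ∈ Q) (hba : b + δ • (b - a) ∈ Q) :
    ∃ η : ℝ, 0 < η ∧ c + η • (c - a) ∈ Q := by
  refine ⟨ε * δ / (1 + δ + ε), by positivity, ?_⟩
  have hne : 1 + δ + ε ≠ 0 := by positivity
  -- The weights are in the ratio `(1 + δ) : ε`, which makes `b` cancel.
  have := hQ hcb hba (a := (1 + δ) / (1 + δ + ε)) (b := ε / (1 + δ + ε)) (by positivity)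
    (by positivity) (by field_simp)
  convert this using 1
  match_scalars <;> field_simp <;> ring

/-! ### The inequality -/

/-- The inner coefficients of a SONC polynomial are dominated by the active ones. -/
theorem sum_abs_inner_le_sum_active {s : ℕ} {g : Fin s → MvPolynomial (Fin n) ℝ}
    (hg : ∀ i, IsCircuit (g i)) (hpsd : ∀ i, IsPSD (g i)) :
    ∑ b ∈ innerExps (∑ i, g i), |(∑ i, g i).coeff b| ≤
      ∑ a ∈ activeExps (∑ i, g i), (∑ i, g i).coeff a := by
  classical
  have hhull := fun i a (ha : a ∈ (g i).support) => expVec_mem_squareHull_sum hg i ha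
  set f := ∑ i, g i with hf
  let P : (Fin n →₀ ℕ) → Prop := fun a => ∃ b ∈ innerExps f, ∃ ε : ℝ, 0 < ε ∧
    expVec b + ε • (expVec b - expVec a) ∈ squareHull f
  let A : Finset (Fin n →₀ ℕ) :=
    (f.support ∪ Finset.univ.biUnion fun i => (g i).support).filter P
  have hcirc : ∀ i, 0 ≤ ∑ a ∈ A, signedCoeff a ((g i).coeff a) := by
    intro i
    rcases (hg i).inner with ⟨b, hb, hbint⟩ | hemp
    · by_cases hbA : b ∈ A
      · refine (sum_signedCoeff_nonneg (hpsd i) hb).trans_eq (Finset.sum_subset ?_ ?_)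
        · intro a ha
          obtain ⟨β, hβ, ε, hε, hmem⟩ := (Finset.mem_filter.1 hbA).2
          obtain ⟨δ, hδ, hmem'⟩ := exists_overshoot_of_mem_intrinsicInterior
            (subset_convexHull ℝ _ (Set.mem_image_of_mem expVec ha)) hbint
          have hsub : newton (g i) ⊆ squareHull f := by
            refine convexHull_min ?_ (convex_convexHull ℝ _)
            rintro _ ⟨a', ha', rfl⟩
            exact hhull i a' ha'
          obtain ⟨η, hη, hmem''⟩ := exists_overshoot_trans (convex_convexHull ℝ _) hε hδ hmem
            (hsub hmem')
          exact Finset.mem_filter.2 ⟨Finset.mem_union_right _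
            (Finset.mem_biUnion.2 ⟨i, Finset.mem_univ _, ha⟩), β, hβ, η, hη, hmem''⟩
        · intro a _ ha
          rw [notMem_support_iff.1 ha, signedCoeff_zero]
      · refine Finset.sum_nonneg fun a ha => signedCoeff_nonneg_of_notMem_innerExps ?_
        rw [hb, Finset.mem_singleton]
        rintro rfl
        exact hbA ha
    · refine Finset.sum_nonneg fun a _ => signedCoeff_nonneg_of_notMem_innerExps ?_
      simp [hemp]
  have htotal : 0 ≤ ∑ a ∈ A, signedCoeff a (f.coeff a) := by
    refine (Finset.sum_nonneg fun i (_ : i ∈ Finset.univ) => hcirc i).trans ?_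
    rw [Finset.sum_comm]
    refine Finset.sum_le_sum fun a _ => ?_
    rw [hf, coeff_sum]
    exact sum_signedCoeff_le _ _ _
  have hinner : innerExps f ⊆ A := by
    intro b hb
    have hbs := (mem_innerExps.1 hb).1
    -- The prolongation of the trivial segment from `b` to `b` is `b` itself.
    refine Finset.mem_filter.2 ⟨Finset.mem_union_left _ hbs, b, hb, 1, one_pos, ?_⟩
    have : ∃ i, b ∈ (g i).support := by
      by_contra! hcon
      refine mem_support_iff.1 hbs ?_
      rw [hf, coeff_sum]
      exact Finset.sum_eq_zero fun i _ => notMem_support_iff.1 (hcon i)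
    obtain ⟨i, hi⟩ := this
    simpa using hhull i b hi
  have hrest : ∑ a ∈ A \ innerExps f, signedCoeff a (f.coeff a) ≤
      ∑ a ∈ activeExps f, f.coeff a := by
    -- What remains are exponents of circuits that cancelled in the sum.
    have hle : ∀ a ∈ A \ innerExps f, a ∉ activeExps f → signedCoeff a (f.coeff a) = 0 := by
      intro a ha hact
      obtain ⟨haA, hain⟩ := Finset.mem_sdiff.1 ha
      obtain ⟨b, hb, ε, hε, hmem⟩ := (Finset.mem_filter.1 haA).2
      have hsq : a ∉ squareExps f := fun h => hact (mem_activeExps_of_overshoot h hb hε hmem)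
      have : f.coeff a = 0 := by
        by_contra hne
        exact hain (Finset.mem_sdiff.2 ⟨mem_support_iff.2 hne, hsq⟩)
      rw [this, signedCoeff_zero]
    rw [← Finset.sum_filter_of_ne fun a ha h => not_not.1 fun h' => h (hle a ha h')]
    have hpos : ∀ a ∈ activeExps f, a ∈ squareExps f := fun a ha => (mem_activeExps.1 ha).1
    rw [Finset.sum_congr rfl fun a ha =>
      signedCoeff_of_mem_squareExps (hpos a (Finset.mem_filter.1 ha).2)]
    exact Finset.sum_le_sum_of_subset_of_nonneg (fun a ha => (Finset.mem_filter.1 ha).2)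
      fun a ha _ => (mem_squareExps.1 (hpos a ha)).2.le
  rw [← Finset.sum_sdiff hinner,
    Finset.sum_congr (s₁ := innerExps f) rfl fun b hb => signedCoeff_of_mem_innerExps hb,
    Finset.sum_neg_distrib] at htotal
  linarith

/-! ### The equality case -/

theorem prod_mul_exp_pow (s y : Fin n → ℝ) (a : Fin n →₀ ℕ) :
    ∏ i, (s i * Real.exp (y i)) ^ a i =
      (∏ i, s i ^ a i) * Real.exp (∑ i, expVec a i * y i) := by
  simp only [mul_pow, Finset.prod_mul_distrib, Real.exp_sum, expVec, Real.exp_nat_mul]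

/-- Nonnegativity of a summand, restricted to the orthant with the worst signs and written in
logarithmic coordinates. -/
theorem IsPSD.piece_exp_nonneg {f : MvPolynomial (Fin n) ℝ} {b : Fin n →₀ ℕ}
    {m : (Fin n →₀ ℕ) → ℝ} {c : ℝ} (h : IsPSD (piece f b m c)) (hb : b ∈ innerExps f)
    (y : Fin n → ℝ) :
    0 ≤ ∑ a ∈ activeExps f, m a * f.coeff a * Real.exp (∑ i, expVec a i * y i) -
      c * |f.coeff b| * Real.exp (∑ i, expVec b i * y i) := by
  obtain ⟨s, hs, hsb⟩ := exists_signs_monomial_eq_neg_abs b (f.coeff b) (mem_innerExps.1 hb).2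
  have hx := h fun i => s i * Real.exp (y i)
  have heval : ∀ (a : Fin n →₀ ℕ) (t : ℝ),
      eval (fun i => s i * Real.exp (y i)) (monomial a t) =
        t * ((∏ i, s i ^ a i) * Real.exp (∑ i, expVec a i * y i)) := by
    intro a t
    rw [eval_monomial, Finsupp.prod_fintype _ _ (fun i => pow_zero _), prod_mul_exp_pow]
  rw [piece, map_add, map_sum, heval] at hx
  rw [Finset.sum_congr rfl fun a ha => by
    rw [heval, prod_signs_pow_even hs (mem_squareExps.1 (mem_activeExps.1 ha).1).1, one_mul]] at hx
  refine hx.trans_eq ?_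
  rw [sub_eq_add_neg]
  congr 1
  calc _ = c * (f.coeff b * ∏ i, s i ^ b i) * Real.exp (∑ i, expVec b i * y i) := by ring
    _ = _ := by rw [hsb]; ring

/-- If a nonnegative exponential sum vanishes at the origin, so does its gradient. -/
theorem sum_smul_eq_of_exp_sum_nonneg {ι : Type*} (A : Finset ι) (v : ι → Fin n → ℝ) (p : ι → ℝ)
    (u : Fin n → ℝ) (q : ℝ)
    (h : ∀ y : Fin n → ℝ, 0 ≤ ∑ a ∈ A, p a * Real.exp (∑ i, v a i * y i) -
      q * Real.exp (∑ i, u i * y i)) (h0 : ∑ a ∈ A, p a = q) :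
    ∑ a ∈ A, p a • v a = q • u := by
  classical
  ext j
  let F : ℝ → ℝ := fun t => ∑ a ∈ A, p a * Real.exp (v a j * t) - q * Real.exp (u j * t)
  have hF : ∀ t, 0 ≤ F t := by
    intro t
    have := h (Pi.single j t)
    simpa [F, Pi.single_apply] using this
  have hF0 : F 0 = 0 := by simp [F, h0]
  have hexp : ∀ k : ℝ, HasDerivAt (fun t : ℝ => Real.exp (k * t)) k 0 := by
    intro k
    simpa using ((hasDerivAt_id (0 : ℝ)).const_mul k).exp
  have hd : HasDerivAt F (∑ a ∈ A, p a * v a j - q * u j) 0 :=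
    (HasDerivAt.fun_sum fun a _ => (hexp (v a j)).const_mul (p a)).sub ((hexp (u j)).const_mul q)
  have hmin : IsLocalMin F 0 := Filter.Eventually.of_forall fun t => hF0.trans_le (hF t)
  have := hmin.hasDerivAt_eq_zero hd
  simp only [Finset.sum_apply, Pi.smul_apply, smul_eq_mul]
  linarith

/-- Uniqueness of barycentric coordinates, for weights of arbitrary total mass. -/
theorem IsBarycentric.eq_mul {V : Finset (Fin n →₀ ℕ)} {b : Fin n →₀ ℕ} {l : (Fin n →₀ ℕ) → ℝ}
    (hl : IsBarycentric V b l) (hV : AffineIndependent ℝ (fun a : V => expVec a.1))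
    {x : (Fin n →₀ ℕ) → ℝ} {q : ℝ} (hx : ∑ a ∈ V, x a = q)
    (hxb : ∑ a ∈ V, x a • expVec a = q • expVec b) {a : Fin n →₀ ℕ} (ha : a ∈ V) :
    x a = q * l a := by
  have := hV.eq_zero_of_sum_eq_zero (s := Finset.univ) (w := fun a : V => x a - q * l a) ?_ ?_
    ⟨a, ha⟩ (Finset.mem_univ _)
  · exact sub_eq_zero.1 this
  · rw [Finset.sum_coe_sort V fun a => x a - q * l a, Finset.sum_sub_distrib, ← Finset.mul_sum, hx,
      hl.sum_eq_one, mul_one, sub_self]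
  · rw [Finset.sum_coe_sort V fun a => (x a - q * l a) • expVec a]
    simp only [sub_smul, Finset.sum_sub_distrib, mul_smul, ← Finset.smul_sum]
    rw [hxb, hl.sum_smul, sub_self]

/-- In case of equality the coefficients of every cancellation-free decomposition are
determined by the barycentric coordinates. -/
theorem IsCancellationFreeDecomposition.coeff_eq {f : MvPolynomial (Fin n) ℝ}
    {mu : (Fin n →₀ ℕ) → Finset (Fin n →₀ ℕ) → (Fin n →₀ ℕ) → ℝ}
    {nu : (Fin n →₀ ℕ) → Finset (Fin n →₀ ℕ) → ℝ}
    {lam : (Fin n →₀ ℕ) → Finset (Fin n →₀ ℕ) → (Fin n →₀ ℕ) → ℝ}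
    (h : IsCancellationFreeDecomposition f mu nu lam)
    (heq : ∑ b ∈ innerExps f, |f.coeff b| = ∑ a ∈ activeExps f, f.coeff a)
    {b : Fin n →₀ ℕ} (hb : b ∈ innerExps f) {V : Finset (Fin n →₀ ℕ)} (hV : V ∈ simplices f b)
    {a : Fin n →₀ ℕ} (ha : a ∈ activeExps f) :
    mu b V a * f.coeff a = nu b V * lam b V a * |f.coeff b| := by
  have hexp := fun b hb V hV => (h.psd b hb V hV).piece_exp_nonneg hb
  have hnonneg : ∀ b ∈ innerExps f, ∀ V ∈ simplices f b,
      0 ≤ ∑ a ∈ activeExps f, mu b V a * f.coeff a - nu b V * |f.coeff b| := by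
    intro b hb V hV
    simpa using hexp b hb V hV 0
  -- The slacks of all pieces add up to the slack of the inequality, so each vanishes.
  have hsum : ∑ b ∈ innerExps f, ∑ V ∈ simplices f b,
      (∑ a ∈ activeExps f, mu b V a * f.coeff a - nu b V * |f.coeff b|) = 0 := by
    have h1 : ∑ b ∈ innerExps f, ∑ V ∈ simplices f b, ∑ a ∈ activeExps f, mu b V a * f.coeff a =
        ∑ a ∈ activeExps f, f.coeff a := by
      rw [Finset.sum_congr rfl fun b _ => Finset.sum_comm, Finset.sum_comm]
      refine Finset.sum_congr rfl fun a ha => ?_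
      simp only [← Finset.sum_mul]
      rw [h.sum_mu a ha, one_mul]
    have h2 : ∑ b ∈ innerExps f, ∑ V ∈ simplices f b, nu b V * |f.coeff b| =
        ∑ b ∈ innerExps f, |f.coeff b| := by
      refine Finset.sum_congr rfl fun b hb => ?_
      rw [← Finset.sum_mul, h.sum_nu b hb, one_mul]
    simp only [Finset.sum_sub_distrib]
    rw [h1, h2, heq, sub_self]
  have htight : ∑ a ∈ activeExps f, mu b V a * f.coeff a = nu b V * |f.coeff b| := by
    have := (Finset.sum_eq_zero_iff_of_nonneg fun b hb =>
      Finset.sum_nonneg (hnonneg b hb)).1 hsum b hb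
    exact sub_eq_zero.1 ((Finset.sum_eq_zero_iff_of_nonneg (hnonneg b hb)).1 this V hV)
  have hgrad := sum_smul_eq_of_exp_sum_nonneg _ _ _ _ _ (hexp b hb V hV) htight
  obtain ⟨hVsq, hVind, -⟩ := mem_simplices.1 hV
  have hVact : V ⊆ activeExps f := fun a ha =>
    mem_activeExps.2 ⟨hVsq ha, b, hb, V, hV, ha⟩
  have hoff : ∀ a ∈ activeExps f, a ∉ V → mu b V a * f.coeff a = 0 := fun a ha haV => by
    rw [h.mu_zero_off b hb V hV a ha haV, zero_mul]
  have hbary := h.barycentric b hb V hV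
  by_cases haV : a ∈ V
  · rw [hbary.eq_mul hVind (x := fun a => mu b V a * f.coeff a)
      ((Finset.sum_subset hVact hoff).trans htight)
      ((Finset.sum_subset hVact fun a ha haV => by rw [hoff a ha haV, zero_smul]).trans hgrad) haV]
    ring
  · rw [hoff a ha haV, hbary.zero_off a haV, mul_zero, zero_mul]

end SONC

theorem mainTheorem4 (n d : ℕ) (f : MvPolynomial (Fin n) ℝ) (hf : SONC.IsSONC d f) :
    (∑ b ∈ SONC.innerExps f, |f.coeff b| ≤ ∑ a ∈ SONC.activeExps f, f.coeff a) ∧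
    (∑ b ∈ SONC.innerExps f, |f.coeff b| = ∑ a ∈ SONC.activeExps f, f.coeff a →
      ∀ (mu : (Fin n →₀ ℕ) → Finset (Fin n →₀ ℕ) → (Fin n →₀ ℕ) → ℝ)
        (nu : (Fin n →₀ ℕ) → Finset (Fin n →₀ ℕ) → ℝ)
        (lam : (Fin n →₀ ℕ) → Finset (Fin n →₀ ℕ) → (Fin n →₀ ℕ) → ℝ),
        SONC.IsCancellationFreeDecomposition f mu nu lam →
        ∀ b ∈ SONC.innerExps f, ∀ V ∈ SONC.simplices f b, ∀ a ∈ SONC.activeExps f,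
          mu b V a * f.coeff a = nu b V * lam b V a * |f.coeff b|) := by
  obtain ⟨s, g, hg, rfl⟩ := hf
  exact ⟨SONC.sum_abs_inner_le_sum_active (fun i => (hg i).2.1) (fun i => (hg i).2.2),
    fun heq _ _ _ h _ hb _ hV _ ha => h.coeff_eq heq hb hV ha⟩
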